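/- Let $\theta\ge 1$ and let $g_x(t)>0$, for $x>0$ and $t>0$, be a family of functions such that $(x,t)\mapsto g_x(t)$ is $C^\infty$ on $(0,\infty)^2$ and $g_1$ extends to $[0,\infty)$ with a (right) derivative at $0$. Assume: (A1) $r^{-\theta}g_x(t)=g_{x/r^\theta}(t/r)$ for all $x,r,t>0$; (A2) there are $\psi>0$ and $c_1>0$ such that $\frac{d}{dt}\bigl(g_1(t)^{1/\theta}\bigr)<\psi$ and $g_1(t)\ge c_1t^\theta$ for all $t\ge 0$; (A3) $g_1'\ge 0$ on $[0,\infty)$, $g_1'$ has only finitely many zeros there, $g_1'(0)>0$ and $\eta:=g_1(0)\in(0,1)$. Let $0=T_0<T_1<T_2<\cdots$, where $(T_k)_{k\ge1}$ are the points of a Poisson process of intensity $1$ on $(0,\infty)$ (that is, the increments $T_k-T_{k-1}$ are independent $\mathrm{Exp}(1)$ random variables), and consider the Markov chain on $(0,\infty)$ $$\Phi_k=g_{\Phi_{k-1}}(T_k-T_{k-1}),\qquad k\ge 1,$$ with $n$-step transition probabilities $P^n(x,A)=\mathbb P(\Phi_n\in A\mid \Phi_0=x)$ and $P=P^1$. Let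 $\xi>0$ be the point with $g_1(\xi)=(1+\eta)/2$. Then there is a constant $c_2>0$ with $g_1(t)\le c_2t^\theta$ for all $t\ge\xi$, and the following hold. (a) There is a unique stationary distribution $\pi$, i.e. a unique probability measure $\pi$ on $(0,\infty)$ with $\pi(A)=\int P(x,A)\,d\pi(x)$ for all Borel sets $A\subset(0,\infty)$. Moreover, for every such constant $c_2$, with $\tilde c:=\dfrac{1}{2c_2^{1/\theta}}$ and $V(x):=\exp(\tilde c\,x^{1/\theta})$: (b) $\int V\,d\pi<\infty$. (c) $\int V(y)\,P^n(x,dy)<\infty$ for all $n\ge 0$ and $x>0$, and there are constants $r>1$ and $R<\infty$ such that for all $x>0$ $$\sum_{n=0}^\infty r^n\,\|P^n(x,\cdot)-\pi\|_V\le R\,V(x),$$ where $\|\nu\|_V:=\sup\{|\int h\,d\nu| : h \text{ measurable},\ |h|\le V \text{ pointwise}\}$. -/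

import Mathlib

open MeasureTheory ProbabilityTheory Set
open scoped ENNReal

/-- A self-affine family `g_x(t)`, written `g x t`, of growth functions with exponent `θ`.
Only the values `g x t` with `x > 0`, `t > 0`, and the values `g 1 0` and `(g 1)'(0)` matter, where
the derivative at the endpoint `0` is the right derivative. -/
structure IsSelfAffineFamily (θ : ℝ) (g : ℝ → ℝ → ℝ) : Prop where
  one_le_theta : 1 ≤ θ
  pos : ∀ x > 0, ∀ t > 0, 0 < g x t
  smooth : ContDiffOn ℝ ((⊤ : ℕ∞) : WithTop ℕ∞) (fun p : ℝ × ℝ => g p.1 p.2) (Ioi 0 ×ˢ Ioi 0)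
  differentiable_zero : DifferentiableWithinAt ℝ (g 1) (Ici 0) 0
  /-- Self-affinity. -/
  self_affine : ∀ x > 0, ∀ r > 0, ∀ t > 0, 1 / r ^ θ * g x t = g (x / r ^ θ) (t / r)
  /-- Upper growth bound: the derivative of `g₁ ^ (1/θ)` is bounded on `[0, ∞)`. -/
  upper_growth : ∃ ψ > 0, ∀ t ≥ 0, derivWithin (fun s => g 1 s ^ (1 / θ)) (Ici 0) t < ψ
  /-- Lower growth bound. -/
  lower_growth : ∃ c₁ > 0, ∀ t ≥ 0, c₁ * t ^ θ ≤ g 1 t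
  /-- Regularity. -/
  finite_zeros : {t | 0 ≤ t ∧ derivWithin (g 1) (Ici 0) t = 0}.Finite
  deriv_nonneg : ∀ t ≥ 0, 0 ≤ derivWithin (g 1) (Ici 0) t
  deriv_zero_pos : 0 < derivWithin (g 1) (Ici 0) 0
  zero_mem : g 1 0 ∈ Ioo (0 : ℝ) 1

/-- `c₂ > 0` is a constant with `g₁(t) ≤ c₂ t ^ θ` for all `t ≥ ξ`, where
`ξ = g₁⁻¹((1 + η) / 2)` and `η = g₁(0)`. (For a self-affine family `g₁` is strictly increasing on
`[0, ∞)`, so that `ξ` is unique.) -/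
def IsTailConstant (θ : ℝ) (g : ℝ → ℝ → ℝ) (c₂ : ℝ) : Prop :=
  0 < c₂ ∧ ∃ ξ > 0, g 1 ξ = (1 + g 1 0) / 2 ∧ ∀ t ≥ ξ, g 1 t ≤ c₂ * t ^ θ

/-- The exponent `c̃ = 1 / (2 c₂ ^ (1/θ))`. -/
noncomputable def cTilde (θ c₂ : ℝ) : ℝ := 1 / (2 * c₂ ^ (1 / θ))

/-- The function `V(x) = exp(c̃ x ^ (1/θ))` on `(0, ∞)`. -/
noncomputable def lyapunovV (θ c₂ : ℝ) (x : ℝ) : ℝ := Real.exp (cTilde θ c₂ * x ^ (1 / θ))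

/-- `T 1, T 2, …` are the successive points of a Poisson process with intensity `1` on `(0, ∞)`,
and `T 0 = 0`: the gaps `T (k + 1) - T k` are independent and exponentially distributed with
parameter `1`. -/
structure IsPoissonOne {Ω : Type*} [MeasurableSpace Ω] (μ : Measure Ω) (T : ℕ → Ω → ℝ) : Prop where
  measurable : ∀ k, Measurable (T k)
  zero : ∀ ω, T 0 ω = 0
  indep : iIndepFun (fun k ω => T (k + 1) ω - T k ω) μ
  law : ∀ k, μ.map (fun ω => T (k + 1) ω - T k ω) = expMeasure 1

/-- The embedded chain started at `x`: `Φ_0 = x` and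
`Φ_k = g_{Φ_{k-1}}(T_k - T_{k-1})` for `k ≥ 1`. -/
def chain {Ω : Type*} (g : ℝ → ℝ → ℝ) (T : ℕ → Ω → ℝ) (x : ℝ) : ℕ → Ω → ℝ
  | 0, _ => x
  | k + 1, ω => g (chain g T x k ω) (T (k + 1) ω - T k ω)

/-- The `n`-step transition probability `P^n(x, ·)`: the law of `Φ_n` when `Φ_0 = x`. -/
noncomputable def transition {Ω : Type*} [MeasurableSpace Ω] (μ : Measure Ω) (g : ℝ → ℝ → ℝ)
    (T : ℕ → Ω → ℝ) (n : ℕ) (x : ℝ) : Measure ℝ :=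
  μ.map (chain g T x n)

/-- `π` is a stationary distribution of the chain on the state space `(0, ∞)`: a probability
measure carried by `(0, ∞)` with `π(A) = ∫ P(x, A) dπ(x)` for all Borel sets `A`. -/
structure IsStationaryLaw {Ω : Type*} [MeasurableSpace Ω] (μ : Measure Ω) (g : ℝ → ℝ → ℝ)
    (T : ℕ → Ω → ℝ) (π : Measure ℝ) : Prop where
  isProbabilityMeasure : IsProbabilityMeasure π
  carried : π (Iic 0) = 0
  invariant : ∀ A, MeasurableSet A → ∫⁻ x, transition μ g T 1 x A ∂π = π A

/-- For measures `μ`, `ν` carried by `(0, ∞)` that integrate `f ≥ 0`, the `f`-norm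
`‖μ - ν‖_f = sup {|μ(h) - ν(h)| : |h| ≤ f}` of their difference, with `h` measurable. -/
noncomputable def fNormSub (f : ℝ → ℝ) (μ ν : Measure ℝ) : ℝ≥0∞ :=
  ⨆ (h : ℝ → ℝ) (_ : Measurable h) (_ : ∀ x > 0, |h x| ≤ f x),
    ENNReal.ofReal |(∫ x, h x ∂μ) - ∫ x, h x ∂ν|

/-!
The proof verifies the hypotheses of Harris' theorem for the chain and proves that theorem in the
form of Hairer and Mattingly.

By self-affinity `g x t = x * g₁(t / x ^ (1 / θ))`, so that in the coordinate `y = x ^ (1 / θ)` the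
chain moves from `y` to `y * h(t / y)`, with `h = g₁ ^ (1 / θ)` and an `Exp(1)` variable `t`.

* Drift (`lyapunovV_step_le`, `stepKernel_drift`). If `t ≤ ξ y`, then `y` is multiplied by at most
  `h(ξ) < 1`; if `t ≥ ξ y`, then the new value is at most `c₂ ^ (1 / θ) * t`, so that `V` of it is at
  most `exp (t / 2)`, which has mean `2`. Thus `P V ≤ V ^ ρ + 2 ≤ V / 2 + K` for some `ρ < 1`.
* Minorization (`exists_minorant`). The bound `h' < ψ` bounds the density of the next `y` from
  below, and `h(t) ≥ c t` bounds the waiting time needed to reach a given level. So all starting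
  points in a sublevel set of `V`, even those near `0`, share a common nonzero part.

`harris` combines the two. With the common part removed on the sublevel set, the kernel becomes a
strict contraction for the weight `1 + β V`. The occupation measure of the contracted kernel then
gives an invariant law (`exists_invariant_of_split`), and the distance of `Pⁿ φ` to the constant
functions decays geometrically (`kernelMean_contraction`). Since `V ≥ 1` this is the asserted bound.

The chain only lives on `(0, ∞)`; the kernel and `V` are extended to `ℝ` through `toPos`, and the
laws of the chain are identified with the iterates of the kernel by `transition_succ`, from the
independence of the gaps.
-/

/-! ### Invariant laws and contraction for Markov kernels -/

section MarkovKernel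

variable {E : Type*} [MeasurableSpace E]

/-- A Markov kernel that splits as `κ x = Q x + s x • ν`, with `Q` a strict contraction in a weight
`W`, has an invariant law that integrates `W`: the normalization of `∑ n, ν Qⁿ`, the occupation
measure of one cycle between regenerations from `ν`. -/
theorem exists_invariant_of_split {κ Q : Kernel E E} [IsMarkovKernel κ] {s : E → ℝ≥0∞}
    (hs : Measurable s) {ν : Measure E} [IsProbabilityMeasure ν]
    (hsplit : ∀ x, κ x = Q x + s x • ν) {W : E → ℝ≥0∞} (hW : Measurable W) (hW1 : ∀ x, 1 ≤ W x)
    (hνW : ∫⁻ x, W x ∂ν ≠ ∞) {a : ℝ≥0∞} (ha : a < 1) (hQW : ∀ x, ∫⁻ y, W y ∂Q x ≤ a * W x) :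
    ∃ π : Measure E, IsProbabilityMeasure π ∧ κ.Invariant π ∧ ∫⁻ x, W x ∂π ≠ ∞ := by
  let m : ℕ → Measure E := fun n => Nat.rec ν (fun _ ρ => ρ.bind Q) n
  have hm0 : m 0 = ν := rfl
  have hms : ∀ n, m (n + 1) = (m n).bind Q := fun n => rfl
  have hmW : ∀ n, ∫⁻ x, W x ∂m n ≤ a ^ n * ∫⁻ x, W x ∂ν := by
    intro n
    induction n with
    | zero => simp [hm0]
    | succ n ih =>
      rw [hms, Measure.lintegral_bind Q.aemeasurable hW.aemeasurable]
      calc ∫⁻ x, ∫⁻ y, W y ∂Q x ∂m n ≤ ∫⁻ x, a * W x ∂m n := lintegral_mono hQW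
        _ = a * ∫⁻ x, W x ∂m n := lintegral_const_mul _ hW
        _ ≤ a * (a ^ n * ∫⁻ x, W x ∂ν) := by gcongr
        _ = _ := by ring
  set S : Measure E := Measure.sum m with hS
  have hSW : ∫⁻ x, W x ∂S ≠ ∞ := by
    rw [hS, lintegral_sum_measure]
    refine ne_top_of_le_ne_top ?_ (ENNReal.tsum_le_tsum hmW)
    rw [ENNReal.tsum_mul_right, ENNReal.tsum_geometric]
    exact ENNReal.mul_ne_top (ENNReal.inv_ne_top.2 (tsub_pos_of_lt ha).ne') hνW
  have hSuniv : S univ ≠ ∞ := by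
    refine ne_top_of_le_ne_top hSW ?_
    calc S univ = ∫⁻ _, 1 ∂S := by simp
      _ ≤ _ := lintegral_mono hW1
  have hSsplit : ∀ A, MeasurableSet A → S A = ν A + ∑' n, m (n + 1) A := by
    intro A hA
    rw [hS, Measure.sum_apply _ hA, tsum_eq_zero_add' ENNReal.summable, hm0]
  have hbind : ∀ A, MeasurableSet A →
      (S.bind κ) A = (∑' n, ∫⁻ x, s x ∂m n) * ν A + ∑' n, m (n + 1) A := by
    intro A hA
    rw [Measure.bind_apply hA κ.aemeasurable, hS, lintegral_sum_measure, ← ENNReal.tsum_mul_right,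
      ← ENNReal.tsum_add]
    congr 1 with n
    rw [hms, Measure.bind_apply hA Q.aemeasurable, ← lintegral_mul_const _ hs,
      ← lintegral_add_left (hs.mul_const _)]
    congr 1 with x
    simp [hsplit, add_comm]
  -- `S` and `S.bind κ` have the same finite mass, so regeneration happens with probability one.
  have hone : ∑' n, ∫⁻ x, s x ∂m n = 1 := by
    have h1 := hbind univ MeasurableSet.univ
    have h2 := hSsplit univ MeasurableSet.univ
    rw [Measure.bind_apply MeasurableSet.univ κ.aemeasurable] at h1
    simp only [measure_univ, lintegral_one, mul_one] at h1 h2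
    have hfin : ∑' n, m (n + 1) univ ≠ ∞ := by
      refine ne_top_of_le_ne_top hSuniv ?_
      rw [h2]; exact le_add_self
    rw [h1] at h2
    exact (ENNReal.add_left_inj hfin).1 h2
  have hinv : S.bind κ = S := by
    ext A hA
    rw [hbind A hA, hSsplit A hA, hone, one_mul]
  have hS0 : S univ ≠ 0 := by
    rw [hSsplit univ MeasurableSet.univ, measure_univ]
    simp
  refine ⟨(S univ)⁻¹ • S, ⟨?_⟩, ?_, ?_⟩
  · simp [ENNReal.inv_mul_cancel hS0 hSuniv]
  · rw [Kernel.Invariant, Measure.comp_smul, hinv]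
  · rw [lintegral_smul_measure]
    exact ENNReal.mul_ne_top (ENNReal.inv_ne_top.2 hS0) hSW

/-- A function whose oscillation is dominated by a weight is within that weight of a constant. -/
theorem exists_center {X : Type*} {F W : X → ℝ} (h : ∀ x y, F x - F y ≤ W x + W y) :
    ∃ c, ∀ x, |F x - c| ≤ W x := by
  rcases isEmpty_or_nonempty X with hE | ⟨⟨x₀⟩⟩
  · exact ⟨0, fun x => (hE.false x).elim⟩
  have : Nonempty X := ⟨x₀⟩
  have hb : BddAbove (range fun x => F x - W x) :=
    ⟨F x₀ + W x₀, by rintro _ ⟨x, rfl⟩; have := h x x₀; simp only; linarith⟩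
  refine ⟨⨆ x, (F x - W x), fun x => abs_le.2 ⟨?_, ?_⟩⟩
  · have : ⨆ y, (F y - W y) ≤ F x + W x := ciSup_le fun y => by have := h y x; linarith
    linarith
  · have := le_ciSup hb x
    linarith

/-- The Markov operator `φ ↦ κ φ` of a kernel on functions, `(κ φ)(x) = ∫ φ(y) κ(x, dy)`. Its
iterates give the `n`-step means; where an integral diverges it has the junk value `0`. -/
noncomputable def kernelMean (κ : Kernel E E) (φ : E → ℝ) (x : E) : ℝ := ∫ y, φ y ∂κ x

theorem measurable_kernelMean (κ : Kernel E E) [IsSFiniteKernel κ] {φ : E → ℝ} (hφ : Measurable φ) :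
    Measurable (kernelMean κ φ) :=
  (hφ.stronglyMeasurable.integral_kernel).measurable

theorem measurable_kernelMean_iterate (κ : Kernel E E) [IsSFiniteKernel κ] {φ : E → ℝ}
    (hφ : Measurable φ) (n : ℕ) : Measurable ((kernelMean κ)^[n] φ) := by
  induction n with
  | zero => exact hφ
  | succ n ih => rw [Function.iterate_succ_apply']; exact measurable_kernelMean κ ih

theorem abs_integral_le_of_abs_le {ρ : Measure E} {f w : E → ℝ} {A : ℝ} (hw : Integrable w ρ)
    (h : ∀ x, |f x| ≤ A * w x) : |∫ x, f x ∂ρ| ≤ A * ∫ x, w x ∂ρ := by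
  rw [← integral_const_mul]
  exact norm_integral_le_of_norm_le (f := f) (hw.const_mul A) (Filter.Eventually.of_forall h)

theorem integrable_of_abs_le {ρ : Measure E} {f w : E → ℝ} {A : ℝ} (hw : Integrable w ρ)
    (hf : Measurable f) (h : ∀ x, |f x| ≤ A * w x) : Integrable f ρ :=
  (hw.const_mul A).mono' hf.aestronglyMeasurable (Filter.Eventually.of_forall h)

section Contraction

variable {κ Q : Kernel E E} [IsMarkovKernel κ] {ν : Measure E} {α : ℝ≥0∞} {C : Set E}
  {w : E → ℝ} {a : ℝ}

/-- One step of the chain contracts, by the factor `a`, the distance from a function to the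
constants in the norm weighted by `w`. Two starting points in `C` share the part `α • ν`, which
cancels in the difference of their means; a pair that is not inside `C` contracts by the drift. -/
theorem kernelMean_contraction (hC : ∀ x ∈ C, κ x = Q x + α • ν) (hC' : ∀ x ∉ C, κ x = Q x)
    (hw : ∀ x, Integrable w (κ x))
    (hQ : ∀ x, ∫ y, w y ∂Q x ≤ a * w x)
    (hmix : ∀ x ∈ C, ∀ y ∉ C, ∫ z, w z ∂κ x + ∫ z, w z ∂κ y ≤ a * (w x + w y))
    {φ : E → ℝ} (hφ : Measurable φ) {A c : ℝ} (hA : 0 ≤ A) (hφw : ∀ x, |φ x - c| ≤ A * w x) :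
    ∃ c', ∀ x, |kernelMean κ φ x - c'| ≤ A * a * w x := by
  have hm : Measurable fun x => φ x - c := hφ.sub_const c
  have hint : ∀ x, Integrable (fun y => φ y - c) (κ x) := fun x =>
    integrable_of_abs_le (hw x) hm hφw
  have hle : ∀ x, Q x ≤ κ x := by
    intro x
    by_cases hx : x ∈ C
    · rw [hC x hx]; exact Measure.le_add_right le_rfl
    · rw [hC' x hx]
  have hbQ : ∀ x, |∫ y, (φ y - c) ∂Q x| ≤ A * (a * w x) := fun x =>
    (abs_integral_le_of_abs_le ((hw x).mono_measure (hle x)) hφw).trans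
      (mul_le_mul_of_nonneg_left (hQ x) hA)
  have hbκ : ∀ x, |∫ y, (φ y - c) ∂κ x| ≤ A * ∫ y, w y ∂κ x := fun x =>
    abs_integral_le_of_abs_le (hw x) hφw
  have hsplit : ∀ x ∈ C, ∫ y, (φ y - c) ∂κ x
      = ∫ y, (φ y - c) ∂Q x + ∫ y, (φ y - c) ∂(α • ν) := by
    intro x hx
    have hle' : α • ν ≤ κ x := by rw [hC x hx]; exact Measure.le_add_left le_rfl
    conv_lhs => rw [hC x hx]
    exact integral_add_measure ((hint x).mono_measure (hle x)) ((hint x).mono_measure hle')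
  obtain ⟨c', hc'⟩ := exists_center (F := fun x => ∫ y, (φ y - c) ∂κ x)
    (W := fun x => A * a * w x) (by
      intro x y
      by_cases hx : x ∈ C <;> by_cases hy : y ∈ C
      · have h1 := abs_le.1 (hbQ x)
        have h2 := abs_le.1 (hbQ y)
        simp only [hsplit x hx, hsplit y hy]
        linarith [h1.2, h2.1]
      · have h1 := abs_le.1 (hbκ x)
        have h2 := abs_le.1 (hbκ y)
        have h3 := mul_le_mul_of_nonneg_left (hmix x hx y hy) hA
        linarith [h1.2, h2.1]
      · have h1 := abs_le.1 (hbκ x)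
        have h2 := abs_le.1 (hbκ y)
        have h3 := mul_le_mul_of_nonneg_left (hmix y hy x hx) hA
        linarith [h1.2, h2.1]
      · have h1 := abs_le.1 (hbQ x)
        have h2 := abs_le.1 (hbQ y)
        rw [← hC' x hx] at h1
        rw [← hC' y hy] at h2
        linarith [h1.2, h2.1])
  refine ⟨c' + c, fun x => ?_⟩
  have : kernelMean κ φ x = ∫ y, (φ y - c) ∂κ x + c := by
    have hi : Integrable φ (κ x) := ((hint x).add (integrable_const c)).congr
      (Filter.Eventually.of_forall fun y => by simp)
    rw [integral_sub hi (integrable_const c)]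
    simp [kernelMean]
  rw [this]
  simpa using hc' x

theorem kernelMean_iterate_contraction (hC : ∀ x ∈ C, κ x = Q x + α • ν)
    (hC' : ∀ x ∉ C, κ x = Q x) (hw : ∀ x, Integrable w (κ x))
    (hQ : ∀ x, ∫ y, w y ∂Q x ≤ a * w x)
    (hmix : ∀ x ∈ C, ∀ y ∉ C, ∫ z, w z ∂κ x + ∫ z, w z ∂κ y ≤ a * (w x + w y))
    (ha : 0 ≤ a) {φ : E → ℝ} (hφ : Measurable φ) {A : ℝ} (hA : 0 ≤ A)
    (hφw : ∀ x, |φ x| ≤ A * w x) (n : ℕ) :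
    ∃ c, ∀ x, |(kernelMean κ)^[n] φ x - c| ≤ A * a ^ n * w x := by
  induction n with
  | zero => exact ⟨0, by simpa using hφw⟩
  | succ n ih =>
    obtain ⟨c, hc⟩ := ih
    obtain ⟨c', hc'⟩ := kernelMean_contraction hC hC' hw hQ hmix
      (measurable_kernelMean_iterate κ hφ n) (by positivity) hc
    refine ⟨c', fun x => ?_⟩
    rw [Function.iterate_succ_apply']
    calc _ ≤ _ := hc' x
      _ = _ := by ring

end Contraction

theorem integral_bind_eq_kernelMean {κ : Kernel E E} [IsSFiniteKernel κ] {ρ : Measure E} [SFinite ρ]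
    {φ : E → ℝ} (hφ : Integrable φ (ρ.bind κ)) :
    ∫ x, φ x ∂(ρ.bind κ) = ∫ x, kernelMean κ φ x ∂ρ := by
  rw [Measure.comp_eq_comp_const_apply] at hφ ⊢
  rw [Kernel.integral_comp hφ]
  simp [kernelMean]

theorem integrable_kernelMean {κ : Kernel E E} [IsSFiniteKernel κ] {ρ : Measure E} [SFinite ρ]
    {φ : E → ℝ} (hφ : Integrable φ (ρ.bind κ)) : Integrable (kernelMean κ φ) ρ := by
  rw [Measure.comp_eq_comp_const_apply] at hφ
  have h := hφ.integral_comp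
  rw [Kernel.const_apply] at h
  exact h

theorem integral_eq_kernelMean_iterate {κ : Kernel E E} [IsSFiniteKernel κ] {ρ : ℕ → Measure E}
    [∀ n, SFinite (ρ n)] (hρ : ∀ n, ρ (n + 1) = (ρ n).bind κ) {φ : E → ℝ}
    (hint : ∀ n, Integrable φ (ρ n)) (n : ℕ) :
    ∫ x, φ x ∂ρ n = ∫ x, (kernelMean κ)^[n] φ x ∂ρ 0 := by
  induction n generalizing φ with
  | zero => rfl
  | succ n ih =>
    have h1 := hint (n + 1)
    rw [hρ] at h1 ⊢
    rw [integral_bind_eq_kernelMean h1, ih (fun k => ?_), Function.iterate_succ_apply]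
    have h2 := hint (k + 1)
    rw [hρ] at h2
    exact integrable_kernelMean h2

/-! ### Harris' theorem -/

/-- The sub-Markov kernel that remains when the part `α • ν` common to all `κ x`, `x ∈ C`, is
subtracted from `κ x` on `C`; off `C` it is `κ`. -/
noncomputable def residualKernel (κ : Kernel E E) (ν : Measure E) [IsFiniteMeasure ν] (α : ℝ≥0∞)
    (hα : α ≠ ∞) (C : Set E) (hC : MeasurableSet C) (hle : ∀ x ∈ C, α • ν ≤ κ x) :
    Kernel E E where
  toFun x := open Classical in if x ∈ C then κ x - α • ν else κ x
  measurable' := by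
    classical
    have : IsFiniteMeasure (α • ν) := ν.smul_finite hα
    refine Measure.measurable_of_measurable_coe _ fun A hA => ?_
    have h : (fun x => (if x ∈ C then κ x - α • ν else κ x) A)
        = fun x => if x ∈ C then κ x A - α * ν A else κ x A := by
      ext x
      split_ifs with hx
      · rw [Measure.sub_apply hA (hle x hx)]; simp
      · rfl
    rw [h]
    exact Measurable.ite hC ((κ.measurable_coe hA).sub_const _) (κ.measurable_coe hA)

theorem residualKernel_of_mem {κ : Kernel E E} {ν : Measure E} [IsFiniteMeasure ν] {α : ℝ≥0∞}
    (hα : α ≠ ∞) {C : Set E} (hC : MeasurableSet C) (hle : ∀ x ∈ C, α • ν ≤ κ x) {x : E}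
    (hx : x ∈ C) : κ x = residualKernel κ ν α hα C hC hle x + α • ν := by
  have : IsFiniteMeasure (α • ν) := ν.smul_finite hα
  have h : residualKernel κ ν α hα C hC hle x = κ x - α • ν := if_pos hx
  rw [h, Measure.sub_add_cancel_of_le (hle x hx)]

theorem residualKernel_of_notMem {κ : Kernel E E} {ν : Measure E} [IsFiniteMeasure ν] {α : ℝ≥0∞}
    (hα : α ≠ ∞) {C : Set E} (hC : MeasurableSet C) (hle : ∀ x ∈ C, α • ν ≤ κ x) {x : E}
    (hx : x ∉ C) : κ x = residualKernel κ ν α hα C hC hle x :=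
  (if_neg hx).symm

/-- **Harris' theorem**, quantitatively: a drift condition for `V` together with a minorization on a
large enough sublevel set of `V` give an invariant law that integrates `V`, is unique among all
probability measures, and to which the chain converges geometrically, uniformly over the test
functions bounded by `1 + V`. The drift factor `1 / 2` and the level `16 * K` are convenient
choices. -/
theorem harris {κ : Kernel E E} [IsMarkovKernel κ] {V : E → ℝ} (hV : Measurable V)
    (hV0 : ∀ x, 0 ≤ V x) {K : ℝ} (hK : 0 < K) (hint : ∀ x, Integrable V (κ x))
    (hdrift : ∀ x, ∫ y, V y ∂κ x ≤ V x / 2 + K) {ν : Measure E} [IsProbabilityMeasure ν]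
    {α : ℝ} (hα : 0 < α) (hα1 : α ≤ 1)
    (hminor : ∀ x, V x ≤ 16 * K → ENNReal.ofReal α • ν ≤ κ x) {x₀ : E} (hx₀ : V x₀ ≤ 16 * K) :
    ∃ π : Measure E, IsProbabilityMeasure π ∧ κ.Invariant π ∧ Integrable V π ∧
      (∀ π' : Measure E, IsProbabilityMeasure π' → κ.Invariant π' → π' = π) ∧
      ∃ a > 0, a < 1 ∧ ∃ D : ℝ, ∀ φ : E → ℝ, Measurable φ → (∀ x, |φ x| ≤ 1 + V x) → ∀ n x,
        |(kernelMean κ)^[n] φ x - ∫ y, φ y ∂π| ≤ D * a ^ n * (1 + V x) := by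
  set C : Set E := {x | V x ≤ 16 * K} with hCdef
  have hCm : MeasurableSet C := measurableSet_le hV measurable_const
  set α' : ℝ≥0∞ := ENNReal.ofReal α with hα'
  have hα't : α' ≠ ∞ := ENNReal.ofReal_ne_top
  have hα'0 : α' ≠ 0 := by simpa [hα'] using hα
  set Q := residualKernel κ ν α' hα't C hCm hminor with hQdef
  have hQC : ∀ x ∈ C, κ x = Q x + α' • ν := fun x hx => residualKernel_of_mem hα't hCm hminor hx
  have hQC' : ∀ x ∉ C, κ x = Q x := fun x hx => residualKernel_of_notMem hα't hCm hminor hx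
  have hQle : ∀ x, Q x ≤ κ x := by
    intro x
    by_cases hx : x ∈ C
    · rw [hQC x hx]; exact Measure.le_add_right le_rfl
    · rw [hQC' x hx]
  have hνV : Integrable V ν := by
    have := (hint x₀).mono_measure (hminor x₀ hx₀)
    exact (integrable_smul_measure hα'0 hα't).1 this
  -- In the weight `1 + β V` the drift constant `K` costs `β K = α / 2`, half of what the
  -- minorization gains on `C`; off `C` the term `β V > 8 α` pays for it.
  set β : ℝ := α / (2 * K) with hβ
  have hβ0 : 0 < β := by positivity
  have hβK : β * K = α / 2 := by rw [hβ]; field_simp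
  set a : ℝ := 1 - α / 4 with ha
  have ha0 : 0 < a := by linarith
  have ha1 : a < 1 := by linarith
  set w : E → ℝ := fun x => 1 + β * V x with hw
  have hw1 : ∀ x, 1 ≤ w x := fun x => by have := mul_nonneg hβ0.le (hV0 x); simp only [hw]; linarith
  have hwm : Measurable w := (hV.const_mul β).const_add 1
  have hwint : ∀ {ρ : Measure E} [IsFiniteMeasure ρ], Integrable V ρ → Integrable w ρ :=
    fun h => (integrable_const 1).add (h.const_mul β)
  have hwκ : ∀ x, Integrable w (κ x) := fun x => hwint (hint x)
  have hκw : ∀ x, ∫ y, w y ∂κ x ≤ 1 + β * (V x / 2) + α / 2 := by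
    intro x
    have h1 : ∫ y, w y ∂κ x = 1 + β * ∫ y, V y ∂κ x := by
      rw [integral_add (integrable_const 1) ((hint x).const_mul β), integral_const_mul]
      simp
    have := mul_le_mul_of_nonneg_left (hdrift x) hβ0.le
    rw [h1]; linarith
  have hout : ∀ {t : ℝ}, 16 * K < t → 8 * α ≤ β * t := by
    intro t ht
    have := mul_le_mul_of_nonneg_left ht.le hβ0.le
    linarith
  have hQw : ∀ x, ∫ y, w y ∂Q x ≤ a * w x := by
    intro x
    by_cases hx : x ∈ C
    · have h1 : ∫ y, w y ∂κ x = ∫ y, w y ∂Q x + ∫ y, w y ∂(α' • ν) := by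
        conv_lhs => rw [hQC x hx]
        exact integral_add_measure ((hwκ x).mono_measure (hQle x))
          ((hwκ x).mono_measure (hminor x hx))
      have h2 : α ≤ ∫ y, w y ∂(α' • ν) := by
        rw [integral_smul_measure, ENNReal.toReal_ofReal hα.le, smul_eq_mul]
        have : (1 : ℝ) ≤ ∫ y, w y ∂ν := by
          calc (1 : ℝ) = ∫ _, (1 : ℝ) ∂ν := by simp
            _ ≤ _ := integral_mono (integrable_const 1) (hwint hνV) hw1
        nlinarith
      have h3 := hκw x
      have h4 : 0 ≤ β * V x := mul_nonneg hβ0.le (hV0 x)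
      simp only [hw, ha] at h1 h2 h3 ⊢
      nlinarith
    · have h3 := hκw x
      have h4 : 8 * α ≤ β * V x := hout (not_le.1 hx)
      rw [← hQC' x hx]
      simp only [hw, ha] at h3 ⊢
      nlinarith
  have hmix : ∀ x ∈ C, ∀ y ∉ C, ∫ z, w z ∂κ x + ∫ z, w z ∂κ y ≤ a * (w x + w y) := by
    intro x _ y hy
    have h1 := hκw x
    have h2 := hκw y
    have h3 : 0 ≤ β * V x := mul_nonneg hβ0.le (hV0 x)
    have h4 : 8 * α ≤ β * V y := hout (not_le.1 hy)
    simp only [hw, ha] at h1 h2 ⊢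
    nlinarith
  -- Existence, from the splitting of `κ` on `C`.
  obtain ⟨π, hπ, hπinv, hπW⟩ : ∃ π : Measure E, IsProbabilityMeasure π ∧ κ.Invariant π ∧
      ∫⁻ x, ENNReal.ofReal (w x) ∂π ≠ ∞ := by
    have hlint : ∀ {ρ : Measure E}, Integrable w ρ →
        ∫⁻ x, ENNReal.ofReal (w x) ∂ρ = ENNReal.ofReal (∫ x, w x ∂ρ) := fun h =>
      (ofReal_integral_eq_lintegral_ofReal h (Filter.Eventually.of_forall fun x =>
        zero_le_one.trans (hw1 x))).symm
    refine exists_invariant_of_split (Q := Q) (s := C.indicator fun _ => α')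
      (measurable_const.indicator hCm) (ν := ν) (fun x => ?_) hwm.ennreal_ofReal
      (fun x => by simpa using hw1 x) ?_ (a := ENNReal.ofReal a) (by simpa using ha1) fun x => ?_
    · by_cases hx : x ∈ C
      · simp [hx, hQC x hx]
      · simp [hx, hQC' x hx]
    · rw [hlint (hwint hνV)]; exact ENNReal.ofReal_ne_top
    · rw [hlint ((hwκ x).mono_measure (hQle x)), ← ENNReal.ofReal_mul ha0.le]
      exact ENNReal.ofReal_le_ofReal (hQw x)
  have hwπ : Integrable w π :=
    (lintegral_ofReal_ne_top_iff_integrable hwm.aestronglyMeasurable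
      (Filter.Eventually.of_forall fun x => zero_le_one.trans (hw1 x))).1 hπW
  have hVπ : Integrable V π := by
    refine integrable_of_abs_le (A := β⁻¹) hwπ hV fun x => ?_
    rw [abs_of_nonneg (hV0 x), hw]
    field_simp
    linarith
  -- Convergence: `κⁿ φ` is close to a constant, which has to be close to `∫ φ ∂π`.
  set A : ℝ := max 1 β⁻¹ with hA
  have hA0 : 0 ≤ A := zero_le_one.trans (le_max_left _ _)
  have hVw : ∀ x, 1 + V x ≤ A * w x := by
    intro x
    have h1 : V x = β⁻¹ * (β * V x) := by field_simp
    have h2 : β⁻¹ * (β * V x) ≤ A * (β * V x) :=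
      mul_le_mul_of_nonneg_right (le_max_right _ _) (mul_nonneg hβ0.le (hV0 x))
    have h3 : 1 ≤ A := le_max_left _ _
    simp only [hw]
    linarith
  have hwV : ∀ x, w x ≤ (1 + β) * (1 + V x) := fun x => by
    have := hV0 x
    simp only [hw]
    nlinarith
  have hconv : ∀ φ : E → ℝ, Measurable φ → (∀ x, |φ x| ≤ 1 + V x) → ∀ n x,
      |(kernelMean κ)^[n] φ x - ∫ y, φ y ∂π|
        ≤ A * (1 + β) * (1 + ∫ y, w y ∂π) * a ^ n * (1 + V x) := by
    intro φ hφ hφV n x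
    have hφw : ∀ x, |φ x| ≤ A * w x := fun x => (hφV x).trans (hVw x)
    obtain ⟨c, hc⟩ := kernelMean_iterate_contraction hQC hQC' hwκ hQw hmix ha0.le hφ hA0 hφw n
    have hm := measurable_kernelMean_iterate κ hφ n
    have h1 : ∫ y, φ y ∂π = ∫ y, (kernelMean κ)^[n] φ y ∂π :=
      integral_eq_kernelMean_iterate (ρ := fun _ => π) (fun _ => hπinv.symm)
        (fun _ => integrable_of_abs_le hwπ hφ hφw) n
    have hi : Integrable (fun y => (kernelMean κ)^[n] φ y - c) π :=
      integrable_of_abs_le hwπ (hm.sub_const c) hc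
    have hi' : Integrable ((kernelMean κ)^[n] φ) π :=
      (hi.add (integrable_const c)).congr (Filter.Eventually.of_forall fun y => by simp)
    have h2 : ∫ y, ((kernelMean κ)^[n] φ y - c) ∂π = ∫ y, φ y ∂π - c := by
      rw [integral_sub hi' (integrable_const c), h1]; simp
    have h3 := abs_integral_le_of_abs_le hwπ hc
    rw [h2] at h3
    have h4 := hc x
    have hW0 : 0 ≤ ∫ y, w y ∂π := integral_nonneg fun y => zero_le_one.trans (hw1 y)
    have h5 : w x + ∫ y, w y ∂π ≤ (1 + β) * (1 + ∫ y, w y ∂π) * (1 + V x) := by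
      have := hwV x
      have h6 : 1 ≤ (1 + β) * (1 + V x) := (hw1 x).trans this
      nlinarith
    calc |(kernelMean κ)^[n] φ x - ∫ y, φ y ∂π|
        ≤ |(kernelMean κ)^[n] φ x - c| + |∫ y, φ y ∂π - c| := by
          rw [abs_sub_comm (∫ y, φ y ∂π) c]; exact abs_sub_le _ _ _
      _ ≤ A * a ^ n * w x + A * a ^ n * ∫ y, w y ∂π := add_le_add h4 h3
      _ = A * a ^ n * (w x + ∫ y, w y ∂π) := by ring
      _ ≤ A * a ^ n * ((1 + β) * (1 + ∫ y, w y ∂π) * (1 + V x)) := by gcongr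
      _ = _ := by ring
  refine ⟨π, hπ, hπinv, hVπ, fun π' hπ' hinv' => ?_, a, ha0, ha1, _, hconv⟩
  -- `π'` need not integrate `V`: pointwise convergence of the bounded functions `κⁿ 1_S` suffices.
  ext S hS
  set φ : E → ℝ := S.indicator 1 with hφdef
  have hφ : Measurable φ := measurable_one.indicator hS
  have hφ1 : ∀ x, |φ x| ≤ 1 := fun x => by
    by_cases hx : x ∈ S <;> simp [hφdef, hx]
  have hφint : ∀ {ρ : Measure E} [IsFiniteMeasure ρ], Integrable φ ρ := fun {ρ} _ =>
    (integrable_const (1 : ℝ)).mono' hφ.aestronglyMeasurable (Filter.Eventually.of_forall hφ1)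
  have h1 : ∀ n, ∫ y, φ y ∂π' = ∫ y, (kernelMean κ)^[n] φ y ∂π' := fun n =>
    integral_eq_kernelMean_iterate (ρ := fun _ => π') (fun _ => hinv'.symm) (fun _ => hφint) n
  have hbd : ∀ n x, |(kernelMean κ)^[n] φ x| ≤ 1 := by
    intro n
    induction n with
    | zero => exact hφ1
    | succ n ih =>
      intro x
      rw [Function.iterate_succ_apply']
      have := abs_integral_le_of_abs_le (ρ := κ x) (A := 1) (integrable_const (1 : ℝ))
        (fun y => by simpa using ih y)
      simpa [kernelMean] using this
  have hlim : Filter.Tendsto (fun n => ∫ y, (kernelMean κ)^[n] φ y ∂π') Filter.atTop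
      (nhds (∫ _, (∫ y, φ y ∂π) ∂π')) := by
    refine tendsto_integral_of_dominated_convergence (fun _ => 1)
      (fun n => (measurable_kernelMean_iterate κ hφ n).aestronglyMeasurable) (integrable_const 1)
      (fun n => Filter.Eventually.of_forall (hbd n)) (Filter.Eventually.of_forall fun x => ?_)
    rw [tendsto_iff_dist_tendsto_zero]
    refine squeeze_zero (fun _ => dist_nonneg)
      (fun n => hconv φ hφ (fun x => (hφ1 x).trans (by linarith [hV0 x])) n x) ?_
    have := ((tendsto_pow_atTop_nhds_zero_of_lt_one ha0.le ha1).const_mul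
      (A * (1 + β) * (1 + ∫ y, w y ∂π))).mul_const (1 + V x)
    simpa using this
  have h2 : ∫ y, φ y ∂π' = ∫ y, φ y ∂π := by
    have h3 : ∫ _, (∫ y, φ y ∂π) ∂π' = ∫ y, φ y ∂π := by simp
    rw [← h3]
    refine tendsto_nhds_unique ?_ hlim
    simp only [← h1]
    exact tendsto_const_nhds
  rw [hφdef, integral_indicator_one hS, integral_indicator_one hS] at h2
  exact (ENNReal.toReal_eq_toReal_iff' (measure_ne_top _ _) (measure_ne_top _ _)).1 h2

end MarkovKernel

/-! ### Growth functions, the transition kernel and the pathwise drift -/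

namespace IsSelfAffineFamily

variable {θ : ℝ} {g : ℝ → ℝ → ℝ}

theorem theta_pos (hg : IsSelfAffineFamily θ g) : 0 < θ := zero_lt_one.trans_le hg.one_le_theta

theorem rpow_inv_rpow (hg : IsSelfAffineFamily θ g) {x : ℝ} (hx : 0 ≤ x) :
    (x ^ (1 / θ)) ^ θ = x := by
  rw [← Real.rpow_mul hx, one_div_mul_cancel hg.theta_pos.ne', Real.rpow_one]

theorem rpow_rpow_inv (hg : IsSelfAffineFamily θ g) {x : ℝ} (hx : 0 ≤ x) :
    (x ^ θ) ^ (1 / θ) = x := by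
  rw [← Real.rpow_mul hx, mul_one_div_cancel hg.theta_pos.ne', Real.rpow_one]

/-- The choice `r = x ^ (1 / θ)` in the self-affinity reduces the family to `g 1`. -/
theorem scaling (hg : IsSelfAffineFamily θ g) {x t : ℝ} (hx : 0 < x) (ht : 0 < t) :
    g x t = x * g 1 (t / x ^ (1 / θ)) := by
  have h := hg.self_affine x hx (x ^ (1 / θ)) (Real.rpow_pos_of_pos hx _) t ht
  rw [hg.rpow_inv_rpow hx.le, div_self hx.ne'] at h
  rw [← h]
  field_simp

theorem one_pos (hg : IsSelfAffineFamily θ g) {t : ℝ} (ht : 0 ≤ t) : 0 < g 1 t := by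
  rcases ht.eq_or_lt with rfl | ht
  · exact hg.zero_mem.1
  · exact hg.pos 1 zero_lt_one t ht

theorem differentiableOn_one (hg : IsSelfAffineFamily θ g) :
    DifferentiableOn ℝ (g 1) (Ici 0) := by
  intro t ht
  rcases (mem_Ici.1 ht).eq_or_lt with rfl | ht
  · exact hg.differentiable_zero
  · have h1 : DifferentiableAt ℝ (fun p : ℝ × ℝ => g p.1 p.2) (1, t) :=
      (hg.smooth.differentiableOn (by simp)).differentiableAt
        ((isOpen_Ioi.prod isOpen_Ioi).mem_nhds ⟨mem_Ioi.2 zero_lt_one, ht⟩)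
    have h2 : DifferentiableAt ℝ (fun s : ℝ => ((1 : ℝ), s)) t :=
      (differentiableAt_const _).prodMk differentiableAt_id
    exact (h1.comp t h2).differentiableWithinAt

theorem monotoneOn_one (hg : IsSelfAffineFamily θ g) : MonotoneOn (g 1) (Ici 0) := by
  refine monotoneOn_of_deriv_nonneg (convex_Ici 0) hg.differentiableOn_one.continuousOn
    (hg.differentiableOn_one.mono interior_subset) fun t ht => ?_
  rw [interior_Ici, mem_Ioi] at ht
  rw [← derivWithin_of_mem_nhds (Ici_mem_nhds ht)]
  exact hg.deriv_nonneg t ht.le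

theorem root_differentiableOn (hg : IsSelfAffineFamily θ g) :
    DifferentiableOn ℝ (fun t => g 1 t ^ (1 / θ)) (Ici 0) := fun t ht =>
  (hg.differentiableOn_one t ht).rpow_const (Or.inl (hg.one_pos ht).ne')

theorem root_monotoneOn (hg : IsSelfAffineFamily θ g) :
    MonotoneOn (fun t => g 1 t ^ (1 / θ)) (Ici 0) := fun _ hs _ ht hst =>
  Real.rpow_le_rpow (hg.one_pos hs).le (hg.monotoneOn_one hs ht hst)
    (one_div_nonneg.2 hg.theta_pos.le)

theorem exists_linear_le_root (hg : IsSelfAffineFamily θ g) :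
    ∃ c > 0, ∀ t ≥ 0, c * t ≤ g 1 t ^ (1 / θ) := by
  obtain ⟨c, hc, h⟩ := hg.lower_growth
  refine ⟨c ^ (1 / θ), Real.rpow_pos_of_pos hc _, fun t ht => ?_⟩
  have := Real.rpow_le_rpow (by positivity) (h t ht) (one_div_nonneg.2 hg.theta_pos.le)
  rwa [Real.mul_rpow hc.le (by positivity), hg.rpow_rpow_inv ht] at this

theorem exists_root_le_linear (hg : IsSelfAffineFamily θ g) :
    ∃ ψ > 0, ∀ t ≥ 0, g 1 t ^ (1 / θ) ≤ g 1 0 ^ (1 / θ) + ψ * t := by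
  obtain ⟨ψ, hψ, h⟩ := hg.upper_growth
  refine ⟨ψ, hψ, fun t ht => ?_⟩
  have := (convex_Ici (0 : ℝ)).image_sub_le_mul_sub_of_deriv_le
    hg.root_differentiableOn.continuousOn (hg.root_differentiableOn.mono interior_subset)
    (C := ψ) (fun s hs => by
      rw [interior_Ici, mem_Ioi] at hs
      rw [← derivWithin_of_mem_nhds (Ici_mem_nhds hs)]
      exact (h s hs.le).le) 0 self_mem_Ici t ht ht
  simp only [sub_zero] at this
  linarith

theorem exists_isTailConstant (hg : IsSelfAffineFamily θ g) : ∃ c₂, IsTailConstant θ g c₂ := by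
  obtain ⟨hη0, hη1⟩ := hg.zero_mem
  obtain ⟨c₁, hc₁, hlow⟩ := hg.lower_growth
  set b : ℝ := (1 / c₁) ^ (1 / θ) with hb
  have hb0 : 0 ≤ b := by positivity
  have hgb : 1 ≤ g 1 b := by
    have := hlow b hb0
    rwa [hb, hg.rpow_inv_rpow (by positivity), mul_one_div_cancel hc₁.ne'] at this
  obtain ⟨ξ, hξ, hξg⟩ : (1 + g 1 0) / 2 ∈ g 1 '' Icc 0 b :=
    intermediate_value_Icc hb0 (hg.differentiableOn_one.continuousOn.mono Icc_subset_Ici_self)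
      ⟨by linarith, by linarith⟩
  have hξ0 : 0 < ξ := by
    rcases hξ.1.eq_or_lt with h | h
    · rw [← h] at hξg; linarith
    · exact h
  obtain ⟨ψ, hψ, hup⟩ := hg.exists_root_le_linear
  have hh0 : 0 < g 1 0 ^ (1 / θ) := Real.rpow_pos_of_pos hη0 _
  refine ⟨(g 1 0 ^ (1 / θ) / ξ + ψ) ^ θ, by positivity, ξ, hξ0, hξg, fun t ht => ?_⟩
  have ht0 : 0 < t := hξ0.trans_le ht
  rw [← Real.mul_rpow (by positivity) ht0.le, ← hg.rpow_inv_rpow (hg.one_pos ht0.le).le]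
  refine Real.rpow_le_rpow (Real.rpow_nonneg (hg.one_pos ht0.le).le _) ?_ hg.theta_pos.le
  have h1 : g 1 0 ^ (1 / θ) ≤ g 1 0 ^ (1 / θ) / ξ * t := by
    rw [div_mul_eq_mul_div, le_div_iff₀ hξ0]
    gcongr
  linarith [hup t ht0.le]

end IsSelfAffineFamily

/-- The identity on `(0, ∞)`, with the value `1` elsewhere. Precomposing with it turns functions
that are only meaningful on `(0, ∞)` into functions on `ℝ` without changing them there. -/
noncomputable def toPos (x : ℝ) : ℝ := if 0 < x then x else 1

theorem toPos_pos (x : ℝ) : 0 < toPos x := by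
  unfold toPos; split_ifs with h <;> simp [h]

theorem toPos_of_pos {x : ℝ} (hx : 0 < x) : toPos x = x := if_pos hx

theorem measurable_toPos : Measurable toPos :=
  Measurable.ite measurableSet_Ioi measurable_id measurable_const

/-- The update `(x, t) ↦ g x t` of the chain, with `toPos` applied to both arguments so that it is
positive and measurable on all of `ℝ × ℝ`. -/
noncomputable def step (g : ℝ → ℝ → ℝ) (x t : ℝ) : ℝ := g (toPos x) (toPos t)

namespace IsSelfAffineFamily

variable {θ : ℝ} {g : ℝ → ℝ → ℝ}

theorem step_pos (hg : IsSelfAffineFamily θ g) (x t : ℝ) : 0 < step g x t :=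
  hg.pos _ (toPos_pos x) _ (toPos_pos t)

theorem measurable_step (hg : IsSelfAffineFamily θ g) :
    Measurable fun q : ℝ × ℝ => step g q.1 q.2 := by
  have h1 := (continuousOn_iff_continuous_domRestrict.1 hg.smooth.continuousOn).measurable
  have h2 : Measurable fun q : ℝ × ℝ =>
      (⟨(toPos q.1, toPos q.2), toPos_pos q.1, toPos_pos q.2⟩ : Ioi (0 : ℝ) ×ˢ Ioi (0 : ℝ)) :=
    ((measurable_toPos.comp measurable_fst).prodMk
      (measurable_toPos.comp measurable_snd)).subtype_mk
  exact h1.comp h2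

theorem measurable_step_right (hg : IsSelfAffineFamily θ g) (x : ℝ) : Measurable (step g x) :=
  hg.measurable_step.comp measurable_prodMk_left

end IsSelfAffineFamily

instance : IsProbabilityMeasure (expMeasure 1) := isProbabilityMeasure_expMeasure zero_lt_one

theorem expMeasure_eq_withDensity (r : ℝ) :
    expMeasure r = volume.withDensity (exponentialPDF r) := rfl

theorem lintegral_expMeasure_one (f : ℝ → ℝ≥0∞) (hf : Measurable f) :
    ∫⁻ t, f t ∂expMeasure 1 = ∫⁻ t in Ioi 0, ENNReal.ofReal (Real.exp (-t)) * f t := by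
  have hm : Measurable (exponentialPDF 1) := (measurable_exponentialPDFReal 1).ennreal_ofReal
  rw [expMeasure_eq_withDensity, lintegral_withDensity_eq_lintegral_mul _ hm hf,
    setLIntegral_congr Ioi_ae_eq_Ici, ← lintegral_indicator measurableSet_Ici]
  congr 1 with t
  by_cases ht : 0 ≤ t
  · simp [ht, exponentialPDF_eq]
  · simp [ht, exponentialPDF_eq]

theorem ae_expMeasure_one_pos : ∀ᵐ t ∂expMeasure 1, 0 < t := by
  have h : expMeasure 1 (Iic 0) = 0 := by
    rw [← lintegral_indicator_one measurableSet_Iic,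
      lintegral_expMeasure_one _ (measurable_one.indicator measurableSet_Iic),
      ← lintegral_indicator measurableSet_Ioi]
    refine (lintegral_congr fun t => ?_).trans lintegral_zero
    by_cases ht : 0 < t
    · simp [ht, not_le.2 ht]
    · simp [ht]
  rw [ae_iff]
  simpa [Iic, not_lt] using h

theorem lintegral_exp_half_expMeasure :
    ∫⁻ t, ENNReal.ofReal (Real.exp (t / 2)) ∂expMeasure 1 = 2 := by
  rw [lintegral_expMeasure_one _ (by fun_prop), setLIntegral_congr Ioi_ae_eq_Ici,
    ← lintegral_indicator measurableSet_Ici]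
  have h : ∀ t, (Ici (0 : ℝ)).indicator (fun t => ENNReal.ofReal (Real.exp (-t)) *
      ENNReal.ofReal (Real.exp (t / 2))) t = 2 * exponentialPDF (1 / 2) t := by
    intro t
    by_cases ht : 0 ≤ t
    · simp only [mem_Ici, ht, indicator_of_mem, exponentialPDF_eq, if_true]
      rw [← ENNReal.ofReal_mul (Real.exp_pos _).le, ← Real.exp_add,
        ← ENNReal.ofReal_ofNat, ← ENNReal.ofReal_mul zero_le_two]
      congr 1
      ring_nf
    · simp [ht, exponentialPDF_eq]
  simp only [h]
  have hm : Measurable (exponentialPDF (1 / 2)) :=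
    (measurable_exponentialPDFReal _).ennreal_ofReal
  rw [lintegral_const_mul _ hm,
    lintegral_exponentialPDF_eq_one (by norm_num), mul_one]

/-- The one-step transition kernel of the chain, on all of `ℝ`: the law of `step g x τ` for an
`Exp(1)` variable `τ`. -/
noncomputable def stepKernel {θ : ℝ} {g : ℝ → ℝ → ℝ} (hg : IsSelfAffineFamily θ g) :
    Kernel ℝ ℝ where
  toFun x := (expMeasure 1).map (step g x)
  measurable' := by
    have h : (fun x => (expMeasure 1).map (step g x)) = fun x =>
        ((expMeasure 1).map (Prod.mk x)).map fun q : ℝ × ℝ => step g q.1 q.2 := by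
      ext1 x
      rw [Measure.map_map hg.measurable_step measurable_prodMk_left]
      rfl
    rw [h]
    exact (Measure.measurable_map _ hg.measurable_step).comp Measurable.map_prodMk_left

namespace IsSelfAffineFamily

variable {θ : ℝ} {g : ℝ → ℝ → ℝ}

theorem stepKernel_apply (hg : IsSelfAffineFamily θ g) (x : ℝ) :
    stepKernel hg x = (expMeasure 1).map (step g x) := rfl

instance (hg : IsSelfAffineFamily θ g) : IsMarkovKernel (stepKernel hg) :=
  ⟨fun x => by
    rw [hg.stepKernel_apply]
    exact Measure.isProbabilityMeasure_map (hg.measurable_step_right x).aemeasurable⟩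

/-- The pathwise form of the drift. If `t ≤ ξ x ^ (1 / θ)`, then `x ^ (1 / θ)` shrinks at least by
the factor `g₁(ξ) ^ (1 / θ) < 1`; otherwise the tail bound makes the exponent at most `t / 2`. -/
theorem lyapunovV_step_le (hg : IsSelfAffineFamily θ g) {c₂ : ℝ} (hc₂ : IsTailConstant θ g c₂) :
    ∃ ρ : ℝ, 0 < ρ ∧ ρ < 1 ∧ ∀ x > 0, ∀ t > 0, lyapunovV θ c₂ (g x t)
      ≤ Real.exp (ρ * (cTilde θ c₂ * x ^ (1 / θ))) + Real.exp (t / 2) := by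
  obtain ⟨hc, ξ, hξ0, hξ, htail⟩ := hc₂
  obtain ⟨hη0, hη1⟩ := hg.zero_mem
  have hcr : 0 < c₂ ^ (1 / θ) := Real.rpow_pos_of_pos hc _
  have hct : 0 < cTilde θ c₂ := by unfold cTilde; positivity
  have hθ' : 0 < 1 / θ := one_div_pos.2 hg.theta_pos
  refine ⟨((1 + g 1 0) / 2) ^ (1 / θ), by positivity,
    Real.rpow_lt_one (by linarith) (by linarith) hθ', fun x hx t ht => ?_⟩
  have hy : 0 < x ^ (1 / θ) := Real.rpow_pos_of_pos hx _
  have hs : 0 < t / x ^ (1 / θ) := div_pos ht hy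
  rw [lyapunovV, hg.scaling hx ht, Real.mul_rpow hx.le (hg.one_pos hs.le).le]
  rcases le_total (t / x ^ (1 / θ)) ξ with h | h
  · refine le_add_of_le_of_nonneg (Real.exp_le_exp.2 ?_) (Real.exp_pos _).le
    have h1 := hg.root_monotoneOn (mem_Ici.2 hs.le) (mem_Ici.2 hξ0.le) h
    simp only [hξ] at h1
    calc _ ≤ cTilde θ c₂ * (x ^ (1 / θ) * ((1 + g 1 0) / 2) ^ (1 / θ)) := by gcongr
      _ = _ := by ring
  · refine le_add_of_nonneg_of_le (Real.exp_pos _).le (Real.exp_le_exp.2 ?_)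
    have h1 := Real.rpow_le_rpow (hg.one_pos hs.le).le (htail _ h) hθ'.le
    rw [Real.mul_rpow hc.le (by positivity), hg.rpow_rpow_inv hs.le] at h1
    calc _ ≤ cTilde θ c₂ * (x ^ (1 / θ) * (c₂ ^ (1 / θ) * (t / x ^ (1 / θ)))) := by gcongr
      _ = t / 2 := by unfold cTilde; field_simp

end IsSelfAffineFamily

/-- A power `ρ < 1` of a large number is at most half of that number. -/
theorem exp_mul_le_half_exp_add {ρ : ℝ} (hρ0 : 0 < ρ) (hρ1 : ρ < 1) (s : ℝ) :
    Real.exp (ρ * s) ≤ Real.exp s / 2 + Real.exp (ρ * (Real.log 2 / (1 - ρ))) := by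
  have h1 : 0 < 1 - ρ := by linarith
  rcases le_total (Real.log 2 / (1 - ρ)) s with h | h
  · rw [div_le_iff₀ h1] at h
    have h2 : Real.exp (ρ * s) ≤ Real.exp s / 2 := by
      rw [le_div_iff₀ two_pos]
      calc Real.exp (ρ * s) * 2 = Real.exp (ρ * s) * Real.exp (Real.log 2) := by
            rw [Real.exp_log two_pos]
        _ = Real.exp (ρ * s + Real.log 2) := (Real.exp_add _ _).symm
        _ ≤ Real.exp s := Real.exp_le_exp.2 (by linarith)
    linarith [Real.exp_pos (ρ * (Real.log 2 / (1 - ρ)))]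
  · have : Real.exp (ρ * s) ≤ Real.exp (ρ * (Real.log 2 / (1 - ρ))) :=
      Real.exp_le_exp.2 (by gcongr)
    linarith [Real.exp_pos s]

/-! ### Minorization, and the laws of the chain -/

namespace IsSelfAffineFamily

variable {θ : ℝ} {g : ℝ → ℝ → ℝ}

/-- The transition probabilities from all points with `x ^ (1 / θ) ≤ L` dominate one nonzero measure.
With `y = x ^ (1 / θ)` and `h = g₁ ^ (1 / θ)`, the chain moves from `y` to `f t = y h(t / y)`. Since
`f' = h'(t / y) < ψ` whatever `y` is, and `t ≤ f t / c`, the density of the new `y` is at least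
`exp (-z / c) / ψ` at every `z > L ≥ f 0`. No lower bound on `f'` is needed. -/
theorem exists_minorant (hg : IsSelfAffineFamily θ g) (L : ℝ) :
    ∃ lam : Measure ℝ, lam univ ≠ 0 ∧ ∀ x > 0, x ^ (1 / θ) ≤ L → lam ≤ stepKernel hg x := by
  obtain ⟨ψ, hψ, hder⟩ := hg.upper_growth
  obtain ⟨c, hc, hlow⟩ := hg.exists_linear_le_root
  obtain ⟨hη0, hη1⟩ := hg.zero_mem
  have hθ' : 0 < 1 / θ := one_div_pos.2 hg.theta_pos
  have hpow : Measurable fun z : ℝ => z ^ θ := by fun_prop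
  set e : ℝ → ℝ≥0∞ := fun z => ENNReal.ofReal (Real.exp (-(z / c))) with he
  have hem : Measurable e := by fun_prop
  refine ⟨ENNReal.ofReal ψ⁻¹ • ((volume.restrict (Ioi L)).withDensity e).map (fun z => z ^ θ),
    ?_, fun x hx hxL => ?_⟩
  · rw [Measure.smul_apply, Measure.map_apply hpow MeasurableSet.univ, preimage_univ,
      withDensity_apply _ MeasurableSet.univ, Measure.restrict_univ, smul_eq_mul]
    refine mul_ne_zero (by simpa using hψ) ?_
    rw [Ne, lintegral_eq_zero_iff hem, Filter.EventuallyEq, ae_iff]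
    have : {z | ¬ e z = (0 : ℝ → ℝ≥0∞) z} = univ := by
      ext z; simp [he, Real.exp_pos]
    rw [this]
    simp
  set y : ℝ := x ^ (1 / θ) with hy
  have hy0 : 0 < y := Real.rpow_pos_of_pos hx _
  set h : ℝ → ℝ := fun t => g 1 t ^ (1 / θ) with hh
  set f : ℝ → ℝ := fun t => y * h (t / y) with hf
  have hfpow : ∀ t > 0, step g x t = f t ^ θ := by
    intro t ht
    have h1 : 0 < g 1 (t / y) := hg.one_pos (div_pos ht hy0).le
    rw [step, toPos_of_pos hx, toPos_of_pos ht, hg.scaling hx ht, hf, hh,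
      Real.mul_rpow hy0.le (by positivity), hg.rpow_inv_rpow hx.le, hg.rpow_inv_rpow h1.le]
  have hflow : ∀ t ≥ 0, c * t ≤ f t := by
    intro t ht
    have := mul_le_mul_of_nonneg_left (hlow (t / y) (by positivity)) hy0.le
    calc c * t = y * (c * (t / y)) := by field_simp
      _ ≤ _ := this
  have hmaps : ∀ t ∈ Ici (0 : ℝ), t / y ∈ Ici (0 : ℝ) := fun t ht => div_nonneg ht hy0.le
  have hfmono : MonotoneOn f (Ici 0) := fun s hs t ht hst =>
    mul_le_mul_of_nonneg_left (hg.root_monotoneOn (hmaps s hs) (hmaps t ht) (by gcongr)) hy0.le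
  have hfder : ∀ t ∈ Ici (0 : ℝ),
      HasDerivWithinAt f (derivWithin h (Ici 0) (t / y)) (Ici 0) t := by
    intro t ht
    have h1 := (hg.root_differentiableOn _ (hmaps t ht)).hasDerivWithinAt
    have h2 : HasDerivWithinAt (fun s => s / y) (1 / y) (Ici 0) t :=
      (hasDerivWithinAt_id t _).div_const y
    have h3 := (h1.scomp t h2 hmaps).const_mul y
    refine h3.congr_deriv ?_
    rw [smul_eq_mul]
    field_simp
    rfl
  have hfcont : ContinuousOn f (Ici 0) := fun t ht => (hfder t ht).continuousWithinAt
  have hf0 : f 0 ≤ L := by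
    have h1 : h 0 ≤ 1 := Real.rpow_le_one hη0.le hη1.le hθ'.le
    calc f 0 = y * h 0 := by simp [hf]
      _ ≤ y * 1 := by gcongr
      _ ≤ L := by simpa using hxL
  have himage : Ioi L ⊆ f '' Ioi 0 := by
    intro z hz
    have hz0 : f 0 < z := hf0.trans_lt hz
    have hz0' : 0 ≤ z := by
      have := hflow 0 le_rfl
      linarith
    obtain ⟨t, ht, rfl⟩ := intermediate_value_Icc (div_nonneg hz0' hc.le)
      (hfcont.mono Icc_subset_Ici_self) ⟨hz0.le, by
        have := hflow (z / c) (by positivity)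
        rwa [mul_div_cancel₀ _ hc.ne'] at this⟩
    refine ⟨t, lt_of_le_of_ne ht.1 ?_, rfl⟩
    rintro rfl
    exact lt_irrefl _ hz0
  refine Measure.le_iff.2 fun A hA => ?_
  set I : ℝ → ℝ≥0∞ := fun z => A.indicator 1 (z ^ θ) with hI
  have hIm : Measurable I := (measurable_one.indicator hA).comp hpow
  have hleft : (ENNReal.ofReal ψ⁻¹ •
      ((volume.restrict (Ioi L)).withDensity e).map (fun z => z ^ θ)) A
      = ENNReal.ofReal ψ⁻¹ * ∫⁻ z in Ioi L, e z * I z := by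
    rw [Measure.smul_apply, smul_eq_mul, ← lintegral_indicator_one hA,
      lintegral_map (measurable_one.indicator hA) hpow,
      lintegral_withDensity_eq_lintegral_mul _ hem hIm]
    rfl
  have hright : stepKernel hg x A
      = ∫⁻ t in Ioi 0, ENNReal.ofReal (Real.exp (-t)) * I (f t) := by
    rw [hg.stepKernel_apply, ← lintegral_indicator_one hA,
      lintegral_map (measurable_one.indicator hA) (hg.measurable_step_right x),
      lintegral_expMeasure_one (fun t => A.indicator 1 (step g x t))
        ((measurable_one.indicator hA).comp (hg.measurable_step_right x))]
    refine setLIntegral_congr_fun measurableSet_Ioi fun t ht => ?_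
    simp only [hI, hfpow t ht]
  rw [hleft, hright]
  -- Substitute `z = f t`, where `f' < ψ` and `t ≤ f t / c`.
  calc ENNReal.ofReal ψ⁻¹ * ∫⁻ z in Ioi L, e z * I z
      ≤ ENNReal.ofReal ψ⁻¹ * ∫⁻ z in f '' Ioi 0, e z * I z := by
        gcongr
    _ = ENNReal.ofReal ψ⁻¹ * ∫⁻ t in Ioi 0,
          ENNReal.ofReal (derivWithin h (Ici 0) (t / y)) * (e (f t) * I (f t)) := by
        rw [lintegral_image_eq_lintegral_deriv_mul_of_monotoneOn measurableSet_Ioi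
          (fun t ht => (hfder t (Ioi_subset_Ici_self ht)).mono Ioi_subset_Ici_self)
          (hfmono.mono Ioi_subset_Ici_self)]
    _ ≤ ENNReal.ofReal ψ⁻¹ * ∫⁻ t in Ioi 0,
          ENNReal.ofReal ψ * (ENNReal.ofReal (Real.exp (-t)) * I (f t)) := by
        refine mul_le_mul_right (setLIntegral_mono' measurableSet_Ioi fun t ht => ?_) _
        have ht0 : 0 < t := ht
        have h1 : e (f t) ≤ ENNReal.ofReal (Real.exp (-t)) := by
          refine ENNReal.ofReal_le_ofReal (Real.exp_le_exp.2 (neg_le_neg ?_))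
          rw [le_div_iff₀ hc, mul_comm]
          exact hflow t ht0.le
        have h2 := (hder (t / y) (by positivity)).le
        gcongr
    _ = ∫⁻ t in Ioi 0, ENNReal.ofReal (Real.exp (-t)) * I (f t) := by
        rw [lintegral_const_mul' _ _ ENNReal.ofReal_ne_top, ← mul_assoc,
          ← ENNReal.ofReal_mul (by positivity), inv_mul_cancel₀ hψ.ne', ENNReal.ofReal_one, one_mul]

end IsSelfAffineFamily

/-- The state at time `k` is a measurable function of the first `k` gaps. -/
theorem chain_step_eq_comp {Ω : Type*} {θ : ℝ} {g : ℝ → ℝ → ℝ} (hg : IsSelfAffineFamily θ g) (T : ℕ → Ω → ℝ) (x : ℝ) (k : ℕ) :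
    ∃ F : (Finset.range k → ℝ) → ℝ, Measurable F ∧
      chain (step g) T x k = fun ω => F fun i => T (i + 1) ω - T i ω := by
  induction k with
  | zero => exact ⟨fun _ => x, measurable_const, rfl⟩
  | succ k ih =>
    obtain ⟨F, hF, hFe⟩ := ih
    refine ⟨fun v => step g (F fun i => v ⟨i, by have := Finset.mem_range.1 i.2; simp; omega⟩)
      (v ⟨k, by simp⟩), ?_, ?_⟩
    · refine hg.measurable_step.comp (Measurable.prodMk (hF.comp ?_) (measurable_pi_apply _))
      exact measurable_pi_lambda _ fun i => measurable_pi_apply _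
    · ext ω
      simp only [chain, hFe]

section Chain

variable {Ω : Type*} [MeasurableSpace Ω] {μ : Measure Ω} {T : ℕ → Ω → ℝ} {θ : ℝ} {g : ℝ → ℝ → ℝ}

theorem IsPoissonOne.measurable_gap (hT : IsPoissonOne μ T) (k : ℕ) :
    Measurable fun ω => T (k + 1) ω - T k ω := (hT.measurable (k + 1)).sub (hT.measurable k)

theorem IsPoissonOne.ae_gap_pos (hT : IsPoissonOne μ T) :
    ∀ᵐ ω ∂μ, ∀ k, 0 < T (k + 1) ω - T k ω := by
  refine ae_all_iff.2 fun k => ?_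
  have h := ae_expMeasure_one_pos
  rw [← hT.law k] at h
  exact ae_of_ae_map (hT.measurable_gap k).aemeasurable h

theorem measurable_chain_step (hg : IsSelfAffineFamily θ g) (hT : IsPoissonOne μ T) (x : ℝ)
    (k : ℕ) : Measurable (chain (step g) T x k) := by
  obtain ⟨F, hF, hFe⟩ := chain_step_eq_comp hg T x k
  rw [hFe]
  exact hF.comp (measurable_pi_lambda _ fun i => hT.measurable_gap i)

theorem indepFun_chain_step_gap (hg : IsSelfAffineFamily θ g) (hT : IsPoissonOne μ T) (x : ℝ)
    (k : ℕ) : IndepFun (chain (step g) T x k) (fun ω => T (k + 1) ω - T k ω) μ := by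
  obtain ⟨F, hF, hFe⟩ := chain_step_eq_comp hg T x k
  have h := hT.indep.indepFun_finset (Finset.range k) {k} (by simp) hT.measurable_gap
  have h' := h.comp hF (measurable_pi_apply (⟨k, by simp⟩ : ({k} : Finset ℕ)))
  rw [hFe]
  exact h'

theorem chain_ae_eq (hg : IsSelfAffineFamily θ g) (hT : IsPoissonOne μ T) {x : ℝ} (hx : 0 < x)
    (k : ℕ) : chain g T x k =ᵐ[μ] chain (step g) T x k := by
  filter_upwards [hT.ae_gap_pos] with ω hω
  have h : chain g T x k ω = chain (step g) T x k ω ∧ 0 < chain g T x k ω := by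
    induction k with
    | zero => exact ⟨rfl, hx⟩
    | succ k ih =>
      refine ⟨?_, hg.pos _ ih.2 _ (hω k)⟩
      rw [chain, chain, ← ih.1, step, toPos_of_pos ih.2, toPos_of_pos (hω k)]
  exact h.1

theorem transition_eq (hg : IsSelfAffineFamily θ g) (hT : IsPoissonOne μ T) {x : ℝ} (hx : 0 < x)
    (k : ℕ) : transition μ g T k x = μ.map (chain (step g) T x k) :=
  Measure.map_congr (chain_ae_eq hg hT hx k)

variable [IsProbabilityMeasure μ]

theorem transition_zero (x : ℝ) : transition μ g T 0 x = Measure.dirac x := by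
  have : chain g T x 0 = fun _ => x := rfl
  rw [transition, this, Measure.map_const, measure_univ, one_smul]

theorem isProbabilityMeasure_transition (hg : IsSelfAffineFamily θ g) (hT : IsPoissonOne μ T)
    {x : ℝ} (hx : 0 < x) (k : ℕ) : IsProbabilityMeasure (transition μ g T k x) := by
  rw [transition_eq hg hT hx]
  exact Measure.isProbabilityMeasure_map (measurable_chain_step hg hT x k).aemeasurable

theorem transition_succ (hg : IsSelfAffineFamily θ g) (hT : IsPoissonOne μ T) {x : ℝ} (hx : 0 < x)
    (k : ℕ) : transition μ g T (k + 1) x = (transition μ g T k x).bind (stepKernel hg) := by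
  rw [transition_eq hg hT hx, transition_eq hg hT hx]
  have hm := measurable_chain_step hg hT x k
  have hgap := hT.measurable_gap k
  have hprob : IsProbabilityMeasure (μ.map (chain (step g) T x k)) :=
    Measure.isProbabilityMeasure_map hm.aemeasurable
  have h1 := (indepFun_iff_map_prod_eq_prod_map_map hm.aemeasurable hgap.aemeasurable).1
    (indepFun_chain_step_gap hg hT x k)
  rw [hT.law k] at h1
  have h2 : μ.map (chain (step g) T x (k + 1))
      = (μ.map fun ω => (chain (step g) T x k ω, T (k + 1) ω - T k ω)).map
        fun q : ℝ × ℝ => step g q.1 q.2 := by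
    rw [Measure.map_map hg.measurable_step (hm.prodMk hgap)]
    rfl
  rw [h2, h1]
  ext A hA
  rw [Measure.map_apply hg.measurable_step hA, Measure.prod_apply (hg.measurable_step hA),
    Measure.bind_apply hA (stepKernel hg).aemeasurable]
  congr 1 with z
  rw [hg.stepKernel_apply, Measure.map_apply (hg.measurable_step_right z) hA]
  rfl

theorem transition_one (hg : IsSelfAffineFamily θ g) (hT : IsPoissonOne μ T) {x : ℝ}
    (hx : 0 < x) : transition μ g T 1 x = stepKernel hg x := by
  rw [transition_succ hg hT hx, transition_zero, Measure.dirac_bind (stepKernel hg).measurable]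

theorem ae_pos_of_carried {π : Measure ℝ} (h : π (Iic 0) = 0) : ∀ᵐ x ∂π, 0 < x := by
  rw [ae_iff]
  simpa [Iic, not_lt] using h

/-- That a stationary law is carried by `(0, ∞)` comes for free, as `stepKernel` has positive
values only. -/
theorem isStationaryLaw_iff (hg : IsSelfAffineFamily θ g) (hT : IsPoissonOne μ T)
    {π : Measure ℝ} : IsStationaryLaw μ g T π ↔ IsProbabilityMeasure π ∧
      (stepKernel hg).Invariant π := by
  have key : π (Iic 0) = 0 → ∀ A, MeasurableSet A →
      ∫⁻ x, transition μ g T 1 x A ∂π = (π.bind (stepKernel hg)) A := by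
    intro h A hA
    rw [Measure.bind_apply hA (stepKernel hg).aemeasurable]
    refine lintegral_congr_ae ?_
    filter_upwards [ae_pos_of_carried h] with x hx
    rw [transition_one hg hT hx]
  constructor
  · rintro ⟨h1, h2, h3⟩
    refine ⟨h1, Measure.ext fun A hA => ?_⟩
    rw [← key h2 A hA, h3 A hA]
  · rintro ⟨h1, h2⟩
    have h3 : π (Iic 0) = 0 := by
      rw [← h2.def, Measure.bind_apply measurableSet_Iic (stepKernel hg).aemeasurable]
      refine (lintegral_congr fun x => ?_).trans lintegral_zero
      rw [hg.stepKernel_apply,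
        Measure.map_apply (hg.measurable_step_right x) measurableSet_Iic]
      have : step g x ⁻¹' Iic 0 = ∅ := by
        ext t
        simpa using hg.step_pos x t
      rw [this, measure_empty]
    refine ⟨h1, h3, fun A hA => ?_⟩
    rw [key h3 A hA, h2.def]

end Chain

/-! ### Geometric ergodicity -/

namespace IsSelfAffineFamily

variable {θ : ℝ} {g : ℝ → ℝ → ℝ} {c₂ : ℝ}

theorem cTilde_pos (hc₂ : IsTailConstant θ g c₂) : 0 < cTilde θ c₂ := by
  have := Real.rpow_pos_of_pos hc₂.1 (1 / θ)
  unfold cTilde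
  positivity

theorem one_le_lyapunovV (hc₂ : IsTailConstant θ g c₂) {x : ℝ} (hx : 0 < x) :
    1 ≤ lyapunovV θ c₂ x :=
  Real.one_le_exp (mul_nonneg (cTilde_pos hc₂).le (Real.rpow_nonneg hx.le _))

theorem lyapunovV_pos (x : ℝ) : 0 < lyapunovV θ c₂ x := Real.exp_pos _

theorem measurable_lyapunovV : Measurable (lyapunovV θ c₂) := by
  unfold lyapunovV
  fun_prop

/-- The drift condition `P V ≤ V / 2 + K`. -/
theorem stepKernel_drift (hg : IsSelfAffineFamily θ g) (hc₂ : IsTailConstant θ g c₂) :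
    ∃ K ≥ 2, ∀ x, Integrable (fun y => lyapunovV θ c₂ (toPos y)) (stepKernel hg x) ∧
      ∫ y, lyapunovV θ c₂ (toPos y) ∂stepKernel hg x ≤ lyapunovV θ c₂ (toPos x) / 2 + K := by
  obtain ⟨ρ, hρ0, hρ1, hstep⟩ := hg.lyapunovV_step_le hc₂
  refine ⟨Real.exp (ρ * (Real.log 2 / (1 - ρ))) + 2, by
    linarith [Real.exp_pos (ρ * (Real.log 2 / (1 - ρ)))], fun x => ?_⟩
  have hVm : Measurable fun y => lyapunovV θ c₂ (toPos y) :=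
    measurable_lyapunovV.comp measurable_toPos
  have hsm := hg.measurable_step_right x
  set b : ℝ := Real.exp (ρ * (cTilde θ c₂ * toPos x ^ (1 / θ))) with hb
  have hexp : Integrable (fun t => Real.exp (t / 2)) (expMeasure 1) := by
    refine (lintegral_ofReal_ne_top_iff_integrable (by fun_prop)
      (Filter.Eventually.of_forall fun t => (Real.exp_pos _).le)).1 ?_
    rw [lintegral_exp_half_expMeasure]
    simp
  have hexp' : ∫ t, Real.exp (t / 2) ∂expMeasure 1 = 2 := by
    rw [integral_eq_lintegral_of_nonneg_ae
      (Filter.Eventually.of_forall fun t => (Real.exp_pos _).le) (by fun_prop),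
      lintegral_exp_half_expMeasure]
    simp
  have hbound : Integrable (fun t => b + Real.exp (t / 2)) (expMeasure 1) :=
    (integrable_const b).add hexp
  have hle : ∀ t, 0 < t →
      lyapunovV θ c₂ (toPos (step g x t)) ≤ b + Real.exp (t / 2) := by
    intro t ht
    rw [toPos_of_pos (hg.step_pos x t), step, toPos_of_pos ht]
    exact hstep _ (toPos_pos x) t ht
  have hint : Integrable (fun t => lyapunovV θ c₂ (toPos (step g x t))) (expMeasure 1) := by
    refine hbound.mono' (hVm.comp hsm).aestronglyMeasurable ?_
    filter_upwards [ae_expMeasure_one_pos] with t ht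
    rw [Real.norm_of_nonneg (lyapunovV_pos _).le]
    exact hle t ht
  rw [hg.stepKernel_apply]
  refine ⟨(integrable_map_measure hVm.aestronglyMeasurable hsm.aemeasurable).2 hint, ?_⟩
  rw [integral_map hsm.aemeasurable hVm.aestronglyMeasurable]
  calc ∫ t, lyapunovV θ c₂ (toPos (step g x t)) ∂expMeasure 1
      ≤ ∫ t, (b + Real.exp (t / 2)) ∂expMeasure 1 := by
        refine integral_mono_ae hint hbound ?_
        filter_upwards [ae_expMeasure_one_pos] with t ht using hle t ht
    _ = b + 2 := by
        rw [integral_add (integrable_const b) hexp, hexp']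
        simp
    _ ≤ _ := by
        have := exp_mul_le_half_exp_add hρ0 hρ1 (cTilde θ c₂ * toPos x ^ (1 / θ))
        rw [lyapunovV]
        linarith

theorem stepKernel_ergodic (hg : IsSelfAffineFamily θ g) (hc₂ : IsTailConstant θ g c₂) :
    ∃ π : Measure ℝ, IsProbabilityMeasure π ∧ (stepKernel hg).Invariant π ∧
      Integrable (fun x => lyapunovV θ c₂ (toPos x)) π ∧
      (∀ π' : Measure ℝ, IsProbabilityMeasure π' → (stepKernel hg).Invariant π' → π' = π) ∧
      ∃ a > 0, a < 1 ∧ ∃ D : ℝ, ∀ φ : ℝ → ℝ, Measurable φ →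
        (∀ x, |φ x| ≤ 1 + lyapunovV θ c₂ (toPos x)) → ∀ n x,
          |(kernelMean (stepKernel hg))^[n] φ x - ∫ y, φ y ∂π|
            ≤ D * a ^ n * (1 + lyapunovV θ c₂ (toPos x)) := by
  obtain ⟨K, hK, hdrift⟩ := hg.stepKernel_drift hc₂
  have hct := cTilde_pos hc₂
  -- On the sublevel set `V ≤ 16 K`, `x ^ (1 / θ) ≤ log (16 K) / c̃`.
  obtain ⟨lam, hlam0, hlam⟩ := hg.exists_minorant (Real.log (16 * K) / cTilde θ c₂)
  have hminor : ∀ x, lyapunovV θ c₂ (toPos x) ≤ 16 * K → lam ≤ stepKernel hg x := by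
    intro x hx
    have h1 : stepKernel hg x = stepKernel hg (toPos x) := by
      have : step g x = step g (toPos x) := by
        ext t
        rw [step, step, toPos_of_pos (toPos_pos x)]
      rw [hg.stepKernel_apply, hg.stepKernel_apply, this]
    rw [h1]
    refine hlam _ (toPos_pos x) ?_
    rw [le_div_iff₀ hct, mul_comm]
    exact (Real.le_log_iff_exp_le (by linarith)).2 hx
  -- The point where `V = exp 1` shows that the sublevel set is not empty.
  have hx₀ : lyapunovV θ c₂ (toPos ((1 / cTilde θ c₂) ^ θ)) ≤ 16 * K := by
    rw [toPos_of_pos (by positivity), lyapunovV, hg.rpow_rpow_inv (by positivity),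
      mul_one_div_cancel hct.ne']
    linarith [Real.exp_one_lt_d9]
  have hlam1 : lam univ ≤ 1 := by
    have := hminor _ hx₀ univ
    rwa [measure_univ (μ := stepKernel hg _)] at this
  have hlamt : lam univ ≠ ∞ := ne_top_of_le_ne_top ENNReal.one_ne_top hlam1
  have hprob : IsProbabilityMeasure ((lam univ)⁻¹ • lam) :=
    ⟨by simp [ENNReal.inv_mul_cancel hlam0 hlamt]⟩
  have hsmul : ENNReal.ofReal (lam univ).toReal • ((lam univ)⁻¹ • lam) = lam := by
    rw [ENNReal.ofReal_toReal hlamt, smul_smul, ENNReal.mul_inv_cancel hlam0 hlamt, one_smul]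
  refine harris (measurable_lyapunovV.comp measurable_toPos) (fun x => (lyapunovV_pos _).le)
    (by linarith : 0 < K) (fun x => (hdrift x).1) (fun x => (hdrift x).2)
    (ν := (lam univ)⁻¹ • lam) (α := (lam univ).toReal) (ENNReal.toReal_pos hlam0 hlamt)
    (ENNReal.toReal_le_of_le_ofReal zero_le_one (by simpa using hlam1)) (fun x hx => ?_) hx₀
  rw [hsmul]
  exact hminor x hx

end IsSelfAffineFamily

open IsSelfAffineFamily in
theorem integrable_lyapunovV_transition {Ω : Type*} [MeasurableSpace Ω] {μ : Measure Ω}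
    [IsProbabilityMeasure μ] {T : ℕ → Ω → ℝ} {θ c₂ : ℝ} {g : ℝ → ℝ → ℝ}
    (hg : IsSelfAffineFamily θ g) (hT : IsPoissonOne μ T) (hc₂ : IsTailConstant θ g c₂) {x : ℝ}
    (hx : 0 < x) (n : ℕ) :
    Integrable (fun y => lyapunovV θ c₂ (toPos y)) (transition μ g T n x) := by
  obtain ⟨K, -, hdrift⟩ := hg.stepKernel_drift hc₂
  have hVm : Measurable fun y => lyapunovV θ c₂ (toPos y) :=
    measurable_lyapunovV.comp measurable_toPos
  induction n with
  | zero => rw [transition_zero]; exact integrable_dirac (by simp)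
  | succ n ih =>
    have := isProbabilityMeasure_transition hg hT hx n
    rw [transition_succ hg hT hx, Measure.integrable_comp_iff hVm.aestronglyMeasurable]
    refine ⟨Filter.Eventually.of_forall fun y => (hdrift y).1, ?_⟩
    have hnorm : ∀ y, ‖lyapunovV θ c₂ (toPos y)‖ = lyapunovV θ c₂ (toPos y) := fun y =>
      Real.norm_of_nonneg (lyapunovV_pos _).le
    simp only [hnorm]
    refine ((ih.div_const 2).add (integrable_const K)).mono'
      (measurable_kernelMean (stepKernel hg) hVm).aestronglyMeasurable
      (Filter.Eventually.of_forall fun y => ?_)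
    rw [Real.norm_of_nonneg (integral_nonneg fun z => (lyapunovV_pos _).le)]
    exact (hdrift y).2

theorem ae_pos_transition {Ω : Type*} [MeasurableSpace Ω] {μ : Measure Ω} {T : ℕ → Ω → ℝ}
    {θ : ℝ} {g : ℝ → ℝ → ℝ} (hg : IsSelfAffineFamily θ g) (hT : IsPoissonOne μ T) {x : ℝ}
    (hx : 0 < x) (n : ℕ) : ∀ᵐ y ∂transition μ g T n x, 0 < y := by
  rw [transition_eq hg hT hx,
    ae_map_iff (measurable_chain_step hg hT x n).aemeasurable measurableSet_Ioi]
  refine Filter.Eventually.of_forall fun ω => ?_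
  cases n with
  | zero => exact hx
  | succ n => exact hg.step_pos _ _

theorem ae_comp_toPos_eq {ρ : Measure ℝ} (h : ∀ᵐ x ∂ρ, 0 < x) (f : ℝ → ℝ) :
    (fun x => f (toPos x)) =ᵐ[ρ] f := by
  filter_upwards [h] with x hx
  rw [toPos_of_pos hx]

theorem fNormSub_transition_le {Ω : Type*} [MeasurableSpace Ω] {μ : Measure Ω}
    [IsProbabilityMeasure μ] {T : ℕ → Ω → ℝ} {θ c₂ : ℝ} {g : ℝ → ℝ → ℝ}
    (hg : IsSelfAffineFamily θ g) (hT : IsPoissonOne μ T) (hc₂ : IsTailConstant θ g c₂)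
    {π : Measure ℝ} (hπ : ∀ᵐ x ∂π, 0 < x) {b : ℝ} {n : ℕ} {x : ℝ} (hx : 0 < x)
    (hb : ∀ φ : ℝ → ℝ, Measurable φ → (∀ y, |φ y| ≤ 1 + lyapunovV θ c₂ (toPos y)) →
      |(kernelMean (stepKernel hg))^[n] φ x - ∫ y, φ y ∂π| ≤ b) :
    fNormSub (lyapunovV θ c₂) (transition μ g T n x) π ≤ ENNReal.ofReal b := by
  refine iSup_le fun h => iSup_le fun hm => iSup_le fun hV => ENNReal.ofReal_le_ofReal ?_
  have hφm : Measurable fun y => h (toPos y) := hm.comp measurable_toPos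
  have hφV : ∀ y, |h (toPos y)| ≤ 1 * lyapunovV θ c₂ (toPos y) := fun y => by
    simpa using hV _ (toPos_pos y)
  have hprob := isProbabilityMeasure_transition hg hT hx
  have h1 := integral_eq_kernelMean_iterate (κ := stepKernel hg)
    (ρ := fun n => transition μ g T n x) (transition_succ hg hT hx)
    (fun k => integrable_of_abs_le (integrable_lyapunovV_transition hg hT hc₂ hx k) hφm hφV) n
  simp only [transition_zero, integral_dirac] at h1
  rw [← integral_congr_ae (ae_comp_toPos_eq (ae_pos_transition hg hT hx n) h),
    ← integral_congr_ae (ae_comp_toPos_eq hπ h), h1]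
  exact hb _ hφm fun y => (hφV y).trans (by linarith)

/-- The rate `r = (1 + a) / (2 a)` satisfies `r > 1` and `r a = (1 + a) / 2 < 1`. -/
theorem tsum_geometric_fNorm_le {F : ℕ → ℝ≥0∞} {a B : ℝ} (ha0 : 0 < a) (ha1 : a < 1)
    (hB : 0 ≤ B) (hF : ∀ n, F n ≤ ENNReal.ofReal (B * a ^ n)) :
    ∑' n, ENNReal.ofReal ((1 + a) / (2 * a)) ^ n * F n ≤ ENNReal.ofReal (2 / (1 - a) * B) := by
  have hr0 : 0 ≤ (1 + a) / (2 * a) := by positivity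
  have hq : (1 + a) / (2 * a) * a = (1 + a) / 2 := by field_simp
  have hterm : ∀ n, ENNReal.ofReal ((1 + a) / (2 * a)) ^ n * F n
      ≤ ENNReal.ofReal (((1 + a) / 2) ^ n * B) := by
    intro n
    calc _ ≤ ENNReal.ofReal (((1 + a) / (2 * a)) ^ n) * ENNReal.ofReal (B * a ^ n) := by
          rw [ENNReal.ofReal_pow hr0]
          gcongr
          exact hF n
      _ = _ := by
          rw [← ENNReal.ofReal_mul (by positivity), ← hq, mul_pow]
          congr 1
          ring
  refine (ENNReal.tsum_le_tsum hterm).trans_eq ?_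
  have hsum : Summable fun n : ℕ => ((1 + a) / 2) ^ n :=
    summable_geometric_of_lt_one (by positivity) (by linarith)
  rw [← ENNReal.ofReal_tsum_of_nonneg (fun n => by positivity) (hsum.mul_right B), tsum_mul_right,
    tsum_geometric_of_lt_one (by positivity) (by linarith)]
  congr 2
  have : (1 - a) ≠ 0 := by linarith
  have : 1 - (1 + a) / 2 = (1 - a) / 2 := by ring
  rw [this, inv_div]

theorem theorem6p1 (θ : ℝ) (g : ℝ → ℝ → ℝ) (hg : IsSelfAffineFamily θ g)
    {Ω : Type*} [MeasurableSpace Ω] (μ : Measure Ω) [IsProbabilityMeasure μ]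
    (T : ℕ → Ω → ℝ) (hT : IsPoissonOne μ T) :
    (∃ c₂, IsTailConstant θ g c₂) ∧
    ∃ π : Measure ℝ,
      -- (a) existence and uniqueness of the stationary distribution
      (IsStationaryLaw μ g T π ∧ ∀ π', IsStationaryLaw μ g T π' → π' = π) ∧
      ∀ c₂, IsTailConstant θ g c₂ →
        -- (b) `π` integrates `V`
        Integrable (lyapunovV θ c₂) π ∧
        -- (c) geometric ergodicity in the `V`-norm, which is well defined here
        (∀ n, ∀ x > 0, Integrable (lyapunovV θ c₂) (transition μ g T n x)) ∧
        ∃ r > 1, ∃ R : ℝ, ∀ x > 0,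
          ∑' n : ℕ, ENNReal.ofReal r ^ n * fNormSub (lyapunovV θ c₂) (transition μ g T n x) π
            ≤ ENNReal.ofReal (R * lyapunovV θ c₂ x) := by
  obtain ⟨c₀, hc₀⟩ := hg.exists_isTailConstant
  obtain ⟨π, hπ, hinv, -, huniq, -⟩ := hg.stepKernel_ergodic hc₀
  have hstat : IsStationaryLaw μ g T π := (isStationaryLaw_iff hg hT).2 ⟨hπ, hinv⟩
  have hπpos : ∀ᵐ x ∂π, 0 < x := ae_pos_of_carried hstat.carried
  refine ⟨⟨c₀, hc₀⟩, π, ⟨hstat, fun π' h' => ?_⟩, fun c₂ hc₂ => ?_⟩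
  · obtain ⟨h1, h2⟩ := (isStationaryLaw_iff hg hT).1 h'
    exact huniq π' h1 h2
  -- The invariant law found with the weight `V` of `c₂` is again `π`.
  obtain ⟨π', hπ', hinv', hVπ, -, a, ha0, ha1, D, hD⟩ := hg.stepKernel_ergodic hc₂
  obtain rfl : π' = π := huniq π' hπ' hinv'
  refine ⟨hVπ.congr (ae_comp_toPos_eq hπpos _), fun n x hx =>
    (integrable_lyapunovV_transition hg hT hc₂ hx n).congr
      (ae_comp_toPos_eq (ae_pos_transition hg hT hx n) _), (1 + a) / (2 * a), ?_,
    2 / (1 - a) * (2 * |D|), fun x hx => ?_⟩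
  · rw [gt_iff_lt, lt_div_iff₀ (by positivity)]
    linarith
  have hV1 := IsSelfAffineFamily.one_le_lyapunovV hc₂ hx
  rw [mul_assoc]
  refine tsum_geometric_fNorm_le ha0 ha1 (by positivity) fun n => ?_
  refine fNormSub_transition_le hg hT hc₂ hπpos hx fun φ hφ hφV => (hD φ hφ hφV n x).trans ?_
  rw [toPos_of_pos hx]
  calc D * a ^ n * (1 + lyapunovV θ c₂ x) ≤ |D| * a ^ n * (2 * lyapunovV θ c₂ x) := by
        gcongr
        · exact le_abs_self D
        · linarith
    _ = 2 * |D| * lyapunovV θ c₂ x * a ^ n := by ring
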